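/- Let $(X,\Xi)$ be a fixed measurable space. Consider the following category. An object is a triple $(S,\Sigma,\mu)$, where $S$ is a separable metric space, $\Sigma$ is its Borel $\sigma$-algebra, and $\mu$ is a Radon subprobability kernel from $X$ to $S$: for each $x\in X$, $\mu^x$ is a Radon measure on $\Sigma$ (that is, $\mu^x(A)=\sup\{\mu^x(K): K\subseteq A \text{ compact}\}$ for all $A\in\Sigma$) with $\mu^x(S)\le 1$, and for each $A\in\Sigma$ the function $x\mapsto\mu^x(A)$ is $\Xi$-measurable. A morphism $h\colon(S,\Sigma,\mu)\to(S',\Sigma',\mu')$ is a surjective $\Sigma$--$\Sigma'$-measurable map $h\colon S\to S'$ such that $\mu^x(h^{-1}(A))=\mu'^x(A)$ for all $x\in X$ and $A\in\Sigma'$. A semipullback of a cospan $S_1\xrightarrow{h_1}S_0\xleftarrow{h_2}S_2$ in this category is an object $S_3$ of the category together with morphisms $k_1\colon S_3\to S_1$ and $k_2\colon S_3\to S_2$ such that $h_1\circ k_1=h_2\circ k_2$. Every cospan $(S_1,\Sigma_1,\mu_1)\xrightarrow{h_1}(S_0,\Sigma_0,\mu_0)\xleftarrow{h_2}(S_2,\Sigma_2,\mu_2)$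 in this category has a semipullback $(S_3,\Sigma_3,\mu_3)$ whose underlying space is the set-theoretic pullback $$S_3=\{(x_1,x_2)\in S_1\times S_2 : h_1(x_1)=h_2(x_2)\},$$ with the subspace metric of the product $S_1\times S_2$ and $\Sigma_3$ the trace on $S_3$ of the product $\sigma$-algebra of $\Sigma_1$ and $\Sigma_2$ (which is the Borel $\sigma$-algebra of $S_3$), and where $k_1,k_2$ are the restrictions to $S_3$ of the coordinate projections. Moreover, $S_3$ belongs to the product $\sigma$-algebra of $\Sigma_1$ and $\Sigma_2$ on $S_1\times S_2$. -/

import Mathlib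

open CategoryTheory MeasureTheory ProbabilityTheory TopologicalSpace

universe u v

/-- A Radon subprobability kernel `(S, Σ, μ)` from the measurable space `X` to a separable metric
space `S`, where `Σ` is the Borel σ-algebra of `S`. A finite Borel measure on a metric space is
Radon when the measure of every Borel set is the supremum of the measures of its compact subsets. -/
structure RadonSubprobKernel (X : Type u) [MeasurableSpace X] where
  /-- the underlying space `S` -/
  carrier : Type v
  [metric : MetricSpace carrier]
  [separable : SeparableSpace carrier]
  [measurable : MeasurableSpace carrier]
  [borel : BorelSpace carrier]
  /-- the kernel `μ` -/
  ker : Kernel X carrier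
  ker_univ_le_one : ∀ x, ker x Set.univ ≤ 1
  ker_radon : ∀ x, (ker x).InnerRegular

namespace RadonSubprobKernel

variable {X : Type u} [MeasurableSpace X]

instance : CoeSort (RadonSubprobKernel.{u, v} X) (Type v) := ⟨carrier⟩

attribute [instance] metric separable measurable borel

/-- A kernel morphism: a surjective measurable map `h` with `μ₁ˣ(h⁻¹(A)) = μ₂ˣ(A)` for all `x ∈ X`
and all measurable `A`. -/
@[ext]
structure Hom (S₁ S₂ : RadonSubprobKernel.{u, v} X) where
  toFun : S₁ → S₂
  measurable_toFun : Measurable toFun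
  surjective_toFun : Function.Surjective toFun
  ker_preimage : ∀ (x : X) (A : Set S₂), MeasurableSet A → S₁.ker x (toFun ⁻¹' A) = S₂.ker x A

/-- The category of Radon subprobability kernels from `X` to separable metric spaces, with
kernel morphisms. -/
instance : Category (RadonSubprobKernel.{u, v} X) where
  Hom := Hom
  id S := ⟨id, measurable_id, Function.surjective_id, fun _ _ _ => rfl⟩
  comp f g := ⟨g.toFun ∘ f.toFun, g.measurable_toFun.comp f.measurable_toFun,
    g.surjective_toFun.comp f.surjective_toFun, fun x A hA => by
      rw [Set.preimage_comp, f.ker_preimage x _ (g.measurable_toFun hA), g.ker_preimage x A hA]⟩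

instance {S₁ S₂ : RadonSubprobKernel.{u, v} X} : CoeFun (S₁ ⟶ S₂) (fun _ => S₁ → S₂) :=
  ⟨fun h => Hom.toFun h⟩

/-- `S₃`, together with `k₁ : S₃ ⟶ S₁` and `k₂ : S₃ ⟶ S₂`, is a semipullback of the cospan
`S₁ ⟶ S₀ ⟵ S₂`: the resulting square of kernel morphisms commutes. -/
def IsSemipullback {S₁ S₀ S₂ S₃ : RadonSubprobKernel.{u, v} X} (h₁ : S₁ ⟶ S₀) (h₂ : S₂ ⟶ S₀)
    (k₁ : S₃ ⟶ S₁) (k₂ : S₃ ⟶ S₂) : Prop :=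
  k₁ ≫ h₁ = k₂ ≫ h₂

/-- The set-theoretic pullback of `S₁ ⟶ S₀ ⟵ S₂`. -/
def setPullback {S₁ S₀ S₂ : RadonSubprobKernel.{u, v} X} (h₁ : S₁ ⟶ S₀) (h₂ : S₂ ⟶ S₀) :
    Set (S₁ × S₂) :=
  {p | h₁ p.1 = h₂ p.2}

instance (S : RadonSubprobKernel.{u, v} X) : SecondCountableTopology S :=
  UniformSpace.secondCountable_of_separable S

/-- The object whose underlying space is a subset `T` of `S₁ × S₂`, with the restriction of the
product metric and the trace of the product σ-algebra (which is the Borel σ-algebra of `T`), and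
whose kernel is the given Radon subprobability kernel `μ` from `X` to `T`. -/
def ofSubsetProd {S₁ S₂ : RadonSubprobKernel.{u, v} X} (T : Set (S₁ × S₂)) (μ : Kernel X T)
    (h_le : ∀ x, μ x Set.univ ≤ 1) (h_radon : ∀ x, (μ x).InnerRegular) :
    RadonSubprobKernel.{u, v} X where
  carrier := T
  ker := μ
  ker_univ_le_one := h_le
  ker_radon := h_radon

end RadonSubprobKernel

/-! Glue the two kernels conditionally independently over `S₀`. The `Sᵢ` need not be standard Borel,
so each is coded by an injection `fᵢ` into Cantor space and `μᵢ` is pushed along `gᵢ = (hᵢ, fᵢ)`.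
Both images have the same `S₀`-marginal and a standard Borel second factor, so they disintegrate
measurably in `x` and `exists_gluing` yields a kernel on `S₀ × 2^ℕ × 2^ℕ`. The Radon property brings
it back: `μᵢˣ` lives on a σ-compact set, whose image under the injection `gᵢ` is measurable, so the
glued measure lives on the copy of the pullback and can be traced there (`exists_pullback`). The
trace is Radon because its marginals are tight. -/

namespace MeasureTheory

/-- A measurable map which is injective sends a σ-compact subset of a metric space to a
measurable set. -/
theorem measurableSet_image_iUnion_isCompact {S Z : Type*} [MetricSpace S] [MeasurableSpace S]
    [BorelSpace S] [MeasurableSpace Z] [MeasurableSpace.CountablySeparated Z] {f : S → Z}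
    (hf : Measurable f) (hinj : Function.Injective f) {K : ℕ → Set S}
    (hK : ∀ n, IsCompact (K n)) : MeasurableSet (f '' ⋃ n, K n) := by
  rw [Set.image_iUnion]
  refine MeasurableSet.iUnion fun n => ?_
  have : CompactSpace (K n) := isCompact_iff_compactSpace.mp (hK n)
  -- A compact metric space is Polish, so Lusin–Souslin applies.
  have he : MeasurableEmbedding (f ∘ ((↑) : K n → S)) :=
    (hf.comp measurable_subtype_coe).measurableEmbedding
      (hinj.comp Subtype.val_injective)
  have h := he.measurableSet_range
  rwa [Set.range_comp, Subtype.range_coe] at h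

/-- A finite inner regular measure is concentrated on a σ-compact set. -/
theorem Measure.InnerRegular.exists_isCompact_measure_compl_iUnion_eq_zero {S : Type*}
    [TopologicalSpace S] [T2Space S] [MeasurableSpace S] [OpensMeasurableSpace S] {μ : Measure S}
    [IsFiniteMeasure μ] (h : μ.InnerRegular) :
    ∃ K : ℕ → Set S, (∀ n, IsCompact (K n)) ∧ μ (⋃ n, K n)ᶜ = 0 := by
  have ht : IsTightMeasureSet {μ} := isTightMeasureSet_singleton_of_innerRegular
  rw [isTightMeasureSet_iff_exists_isCompact_measure_compl_le] at ht
  obtain ⟨u, -, hu0, hu⟩ := exists_seq_strictAnti_tendsto' (show (0 : ENNReal) < 1 by simp)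
  choose K hK hKu using fun n => ht (u n) (hu0 n).1
  refine ⟨K, hK, le_antisymm (ge_of_tendsto' hu fun n => ?_) zero_le⟩
  exact (measure_mono (Set.compl_subset_compl.mpr (Set.subset_iUnion K n))).trans (hKu n μ rfl)

/-- A tight finite Borel measure on a metric space is inner regular. -/
theorem innerRegular_of_isTightMeasureSet {S : Type*} [MetricSpace S] [MeasurableSpace S]
    [BorelSpace S] {μ : Measure S} [IsFiniteMeasure μ] (h : IsTightMeasureSet {μ}) :
    μ.InnerRegular := by
  rw [isTightMeasureSet_iff_exists_isCompact_measure_compl_le] at h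
  have hc : μ.InnerRegularWRT IsCompact IsClosed := by
    refine innerRegularWRT_of_exists_compl_lt (fun A B hA hB => hA.inter_right hB) fun ε hε => ?_
    obtain ⟨δ, hδ0, hδ⟩ := exists_between hε
    obtain ⟨K, hK, hKμ⟩ := h δ hδ0
    exact ⟨K, hK, (hKμ μ rfl).trans_lt hδ⟩
  suffices μ.InnerRegularCompactLTTop from inferInstance
  -- Compact sets approximate closed sets, closed sets approximate open sets in a metric space, and
  -- finiteness extends this to measurable sets.
  exact ⟨Measure.InnerRegularWRT.measurableSet_of_isOpen
    (hc.trans (Measure.InnerRegularWRT.of_pseudoMetrizableSpace μ))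
    fun s t hs ht => hs.inter_right ht.isClosed_compl⟩

/-- A measure on a measurable subset of `S` is inner regular if its image in `S` is. -/
theorem Measure.InnerRegular.of_map_subtype_coe {S : Type*} [TopologicalSpace S]
    [MeasurableSpace S] {T : Set S} (hT : MeasurableSet T) {μ : Measure T}
    (h : (μ.map Subtype.val).InnerRegular) : μ.InnerRegular := by
  have he := MeasurableEmbedding.subtype_coe hT
  refine ⟨fun A hA r hr => ?_⟩
  rw [← Set.preimage_image_eq A Subtype.val_injective, ← he.map_apply] at hr
  obtain ⟨K, hKA, hK, hrK⟩ := h.innerRegular (he.measurableSet_image.mpr hA) r hr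
  refine ⟨(↑) ⁻¹' K, ?_, ?_, ?_⟩
  · rw [← Set.preimage_image_eq A Subtype.val_injective]
    exact Set.preimage_mono hKA
  · refine Topology.IsInducing.subtypeVal.isCompact_preimage_iff ?_ |>.mpr hK
    exact hKA.trans (Set.image_subset_range _ _)
  · rwa [he.map_apply] at hrK

/-- A finite measure on a measurable subset of a product of two separable metric spaces is inner
regular if both of its marginals are. -/
theorem Measure.InnerRegular.of_marginals {S₁ S₂ : Type*} [MetricSpace S₁] [MetricSpace S₂]
    [SecondCountableTopology S₁] [SecondCountableTopology S₂]
    [MeasurableSpace S₁] [MeasurableSpace S₂] [BorelSpace S₁] [BorelSpace S₂]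
    {T : Set (S₁ × S₂)} (hT : MeasurableSet T) {μ : Measure T} [IsFiniteMeasure μ]
    (h₁ : (μ.map fun p => p.1.1).InnerRegular) (h₂ : (μ.map fun p => p.1.2).InnerRegular) :
    μ.InnerRegular := by
  have ht : IsTightMeasureSet {μ.map Subtype.val} := by
    refine IsTightMeasureSet.prodMk ?_ ?_
    · rw [Set.image_singleton, Measure.fst, Measure.map_map measurable_fst measurable_subtype_coe]
      exact isTightMeasureSet_singleton_of_innerRegular (h := h₁)
    · rw [Set.image_singleton, Measure.snd, Measure.map_map measurable_snd measurable_subtype_coe]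
      exact isTightMeasureSet_singleton_of_innerRegular (h := h₂)
  exact .of_map_subtype_coe hT (innerRegular_of_isTightMeasureSet ht)

/-- A countably generated measurable space which separates points is isomorphic to a subspace of
the Cantor space. -/
theorem exists_measurable_injective_comap_eq_nat_bool (S : Type*) [mS : MeasurableSpace S]
    [MeasurableSpace.CountablyGenerated S] [MeasurableSpace.SeparatesPoints S] :
    ∃ f : S → ℕ → Bool, Measurable f ∧ Function.Injective f ∧
      MeasurableSpace.comap f inferInstance = mS := by
  obtain ⟨s, ⟨e⟩⟩ := MeasurableSpace.measurableEquiv_nat_bool_of_countablyGenerated S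
  refine ⟨fun x => e x, measurable_subtype_coe.comp e.measurable,
    Subtype.val_injective.comp e.injective, ?_⟩
  have h : MeasurableSpace.comap e (MeasurableSpace.comap Subtype.val inferInstance) = mS :=
    e.measurableEmbedding.comap_eq
  rwa [MeasurableSpace.comap_comp] at h

end MeasureTheory

/-! ### Traces, gluing and pullbacks of kernels -/

namespace ProbabilityTheory.Kernel

/-- The trace of a kernel on a subspace which is of full outer measure. -/
theorem exists_map_eq_of_measure_compl_range {X T Z : Type*} [MeasurableSpace X]
    [mT : MeasurableSpace T] [mZ : MeasurableSpace Z] (κ : Kernel X Z) {j : T → Z}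
    (hinj : Function.Injective j) (hj : MeasurableSpace.comap j mZ = mT)
    (hκ : ∀ x, κ x (Set.range j)ᶜ = 0) : ∃ η : Kernel X T, η.map j = κ := by
  have hjm : Measurable j := hj ▸ comap_measurable j
  -- The range need not be measurable, only null-measurable for each `κ x`.
  have hrange x : NullMeasurableSet (Set.range j) (κ x) :=
    NullMeasurableSet.compl_iff.mp (NullMeasurableSet.of_null (hκ x))
  have himage x (A : Set T) (hA : MeasurableSet A) : NullMeasurableSet (j '' A) (κ x) := by
    rw [← hj] at hA
    obtain ⟨B, hB, rfl⟩ := hA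
    rw [Set.image_preimage_eq_inter_range]
    exact hB.nullMeasurableSet.inter (hrange x)
  have hcomap x (B : Set Z) (hB : MeasurableSet B) : (κ x).comap j (j ⁻¹' B) = κ x B := by
    rw [Measure.comap_apply₀ j _ hinj (himage x) (hjm hB).nullMeasurableSet,
      Set.image_preimage_eq_inter_range]
    exact measure_inter_conull (hκ x)
  refine ⟨⟨fun x => (κ x).comap j, Measure.measurable_of_measurable_coe _ fun A hA => ?_⟩, ?_⟩
  -- Writing `A = j ⁻¹' B` with `B` independent of `x` turns the trace into `κ x B`, measurable in
  -- `x`.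
  · rw [← hj] at hA
    obtain ⟨B, hB, rfl⟩ := hA
    simp_rw [hcomap _ B hB]
    exact κ.measurable_coe hB
  · ext x B hB
    rw [map_apply' _ hjm _ hB]
    exact hcomap x B hB

/-- Two finite kernels with a common marginal glue along it. -/
theorem exists_gluing {X S Ω₁ Ω₂ : Type*} [MeasurableSpace X] [MeasurableSpace S]
    [MeasurableSpace.CountablyGenerated S] [MeasurableSpace Ω₁] [StandardBorelSpace Ω₁]
    [Nonempty Ω₁] [MeasurableSpace Ω₂] [StandardBorelSpace Ω₂] [Nonempty Ω₂]
    (κ₁ : Kernel X (S × Ω₁)) (κ₂ : Kernel X (S × Ω₂)) [IsFiniteKernel κ₁] [IsFiniteKernel κ₂]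
    (h : κ₁.fst = κ₂.fst) :
    ∃ κ : Kernel X (S × Ω₁ × Ω₂),
      κ.map (fun p => (p.1, p.2.1)) = κ₁ ∧ κ.map (fun p => (p.1, p.2.2)) = κ₂ := by
  -- The coordinates in `Ω₁` and `Ω₂` are made independent given `x` and the point of `S`.
  refine ⟨κ₁.fst ⊗ₖ (κ₁.condKernel ×ₖ κ₂.condKernel), ?_, ?_⟩
  · conv_rhs => rw [← disintegrate κ₁ κ₁.condKernel]
    ext x A hA
    have hm : Measurable fun p : S × Ω₁ × Ω₂ => (p.1, p.2.1) := by fun_prop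
    rw [map_apply' _ hm _ hA, compProd_apply (hm hA), compProd_apply hA]
    refine lintegral_congr fun s => ?_
    have hs : MeasurableSet (Prod.mk s ⁻¹' A) := measurable_prodMk_left hA
    rw [← fst_prod κ₁.condKernel κ₂.condKernel, fst_apply' _ _ hs, fst_prod]
    rfl
  · conv_rhs => rw [← disintegrate κ₂ κ₂.condKernel]
    rw [h]
    ext x A hA
    have hm : Measurable fun p : S × Ω₁ × Ω₂ => (p.1, p.2.2) := by fun_prop
    rw [map_apply' _ hm _ hA, compProd_apply (hm hA), compProd_apply hA]
    refine lintegral_congr fun s => ?_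
    have hs : MeasurableSet (Prod.mk s ⁻¹' A) := measurable_prodMk_left hA
    rw [← snd_prod κ₁.condKernel κ₂.condKernel, snd_apply' _ _ hs, snd_prod]
    rfl

/-- Two finite Radon kernels on separable metric spaces which have the same image under
measurable maps `h₁` and `h₂` are the marginals of a kernel on the pullback of `h₁` and `h₂`. -/
theorem exists_pullback {X S₁ S₀ S₂ : Type*} [MeasurableSpace X]
    [MetricSpace S₁] [SecondCountableTopology S₁] [MeasurableSpace S₁] [BorelSpace S₁]
    [MetricSpace S₂] [SecondCountableTopology S₂] [MeasurableSpace S₂] [BorelSpace S₂]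
    [MeasurableSpace S₀] [MeasurableSpace.CountablyGenerated S₀]
    [MeasurableSingletonClass S₀]
    (μ₁ : Kernel X S₁) (μ₂ : Kernel X S₂) [IsFiniteKernel μ₁] [IsFiniteKernel μ₂]
    (hμ₁ : ∀ x, (μ₁ x).InnerRegular) (hμ₂ : ∀ x, (μ₂ x).InnerRegular)
    {h₁ : S₁ → S₀} {h₂ : S₂ → S₀} (hh₁ : Measurable h₁) (hh₂ : Measurable h₂)
    (h : μ₁.map h₁ = μ₂.map h₂) :
    ∃ μ : Kernel X {p : S₁ × S₂ | h₁ p.1 = h₂ p.2},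
      μ.map (fun p => p.1.1) = μ₁ ∧ μ.map (fun p => p.1.2) = μ₂ := by
  obtain ⟨f₁, hf₁, hinj₁, hcomap₁⟩ := exists_measurable_injective_comap_eq_nat_bool S₁
  obtain ⟨f₂, hf₂, hinj₂, hcomap₂⟩ := exists_measurable_injective_comap_eq_nat_bool S₂
  have : MeasurableSpace.CountablyGenerated (ℕ → Bool) :=
    countablyGenerated_of_standardBorel
  have : MeasurableSpace.SeparatesPoints (S₀ × (ℕ → Bool)) :=
    MeasurableSpace.separatesPoints_of_measurableSingletonClass
  have : MeasurableSpace.CountablySeparated (S₀ × (ℕ → Bool)) :=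
    MeasurableSpace.countablySeparated_of_separatesPoints
  let g₁ : S₁ → S₀ × (ℕ → Bool) := fun s => (h₁ s, f₁ s)
  let g₂ : S₂ → S₀ × (ℕ → Bool) := fun s => (h₂ s, f₂ s)
  have hg₁ : Measurable g₁ := hh₁.prodMk hf₁
  have hg₂ : Measurable g₂ := hh₂.prodMk hf₂
  have hginj₁ : Function.Injective g₁ := fun a b hab => hinj₁ (congrArg Prod.snd hab)
  have hginj₂ : Function.Injective g₂ := fun a b hab => hinj₂ (congrArg Prod.snd hab)
  have hfst : (μ₁.map g₁).fst = (μ₂.map g₂).fst := by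
    rw [fst_eq, fst_eq, ← map_comp_right _ hg₁ measurable_fst,
      ← map_comp_right _ hg₂ measurable_fst]
    exact h
  obtain ⟨κ, hκ₁, hκ₂⟩ := exists_gluing (μ₁.map g₁) (μ₂.map g₂) hfst
  have hπ₁ : Measurable fun p : S₀ × (ℕ → Bool) × (ℕ → Bool) => (p.1, p.2.1) := by fun_prop
  have hπ₂ : Measurable fun p : S₀ × (ℕ → Bool) × (ℕ → Bool) => (p.1, p.2.2) := by fun_prop
  let j : {p : S₁ × S₂ | h₁ p.1 = h₂ p.2} → S₀ × (ℕ → Bool) × (ℕ → Bool) :=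
    fun p => (h₁ p.1.1, f₁ p.1.1, f₂ p.1.2)
  have hjm : Measurable j := by fun_prop
  have hjinj : Function.Injective j := fun p q hpq => by
    simp only [j, Prod.mk.injEq] at hpq
    exact Subtype.ext (Prod.ext (hinj₁ hpq.2.1) (hinj₂ hpq.2.2))
  have hjcomap : MeasurableSpace.comap j inferInstance =
      (inferInstance : MeasurableSpace {p : S₁ × S₂ | h₁ p.1 = h₂ p.2}) := by
    refine le_antisymm hjm.comap_le ?_
    have hj₁ : Measurable[MeasurableSpace.comap j inferInstance]
        fun p : {p : S₁ × S₂ | h₁ p.1 = h₂ p.2} => p.1.1 := by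
      rw [measurable_iff_comap_le, ← hcomap₁, MeasurableSpace.comap_comp]
      exact ((measurable_fst.comp measurable_snd).comp (comap_measurable j)).comap_le
    have hj₂ : Measurable[MeasurableSpace.comap j inferInstance]
        fun p : {p : S₁ × S₂ | h₁ p.1 = h₂ p.2} => p.1.2 := by
      rw [measurable_iff_comap_le, ← hcomap₂, MeasurableSpace.comap_comp]
      exact ((measurable_snd.comp measurable_snd).comp (comap_measurable j)).comap_le
    exact (hj₁.prodMk hj₂).comap_le
  -- The σ-compact sets may depend on `x`, since only nullity for each `x` is needed.
  have hrange x : κ x (Set.range j)ᶜ = 0 := by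
    obtain ⟨K₁, hK₁, hK₁μ⟩ := (hμ₁ x).exists_isCompact_measure_compl_iUnion_eq_zero
    obtain ⟨K₂, hK₂, hK₂μ⟩ := (hμ₂ x).exists_isCompact_measure_compl_iUnion_eq_zero
    have hG₁ := (measurableSet_image_iUnion_isCompact hg₁ hginj₁ hK₁).compl
    have hG₂ := (measurableSet_image_iUnion_isCompact hg₂ hginj₂ hK₂).compl
    have hnull₁ : κ x ((fun p => (p.1, p.2.1)) ⁻¹' (g₁ '' ⋃ n, K₁ n)ᶜ) = 0 := by
      rw [← map_apply' _ hπ₁ _ hG₁, hκ₁, map_apply' _ hg₁ _ hG₁, Set.preimage_compl,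
        Set.preimage_image_eq _ hginj₁, hK₁μ]
    have hnull₂ : κ x ((fun p => (p.1, p.2.2)) ⁻¹' (g₂ '' ⋃ n, K₂ n)ᶜ) = 0 := by
      rw [← map_apply' _ hπ₂ _ hG₂, hκ₂, map_apply' _ hg₂ _ hG₂, Set.preimage_compl,
        Set.preimage_image_eq _ hginj₂, hK₂μ]
    refine measure_mono_null ?_ (measure_union_null hnull₁ hnull₂)
    -- Off both null sets, `(s, a) = g₁ s₁` and `(s, b) = g₂ s₂`; the shared `s` puts `(s₁, s₂)` in
    -- the pullback.
    rintro ⟨s, a, b⟩ hp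
    by_contra hcon
    simp only [Set.mem_union, Set.mem_preimage, Set.mem_compl_iff, not_or, not_not] at hcon
    obtain ⟨⟨s₁, -, e₁⟩, ⟨s₂, -, e₂⟩⟩ := hcon
    simp only [g₁, g₂, Prod.mk.injEq] at e₁ e₂
    exact hp ⟨⟨(s₁, s₂), e₁.1.trans e₂.1.symm⟩, by simp [j, e₁, e₂]⟩
  obtain ⟨μ, rfl⟩ := exists_map_eq_of_measure_compl_range κ hjinj hjcomap hrange
  have hp₁ : Measurable fun p : {p : S₁ × S₂ | h₁ p.1 = h₂ p.2} => p.1.1 := by fun_prop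
  have hp₂ : Measurable fun p : {p : S₁ × S₂ | h₁ p.1 = h₂ p.2} => p.1.2 := by fun_prop
  rw [← map_comp_right _ hjm hπ₁] at hκ₁
  rw [← map_comp_right _ hjm hπ₂] at hκ₂
  refine ⟨μ, ?_, ?_⟩
  · ext x A hA
    -- Every measurable set of `S₁` is some `f₁ ⁻¹' B`, so testing on the Cantor coordinate
    -- suffices.
    rw [← hcomap₁] at hA
    obtain ⟨B, hB, rfl⟩ := hA
    have hκB := congrArg (fun η => η x (Prod.snd ⁻¹' B)) hκ₁
    simp only [map_apply' _ (hπ₁.comp hjm) _ (measurable_snd hB),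
      map_apply' _ hg₁ _ (measurable_snd hB)] at hκB
    rw [map_apply' _ hp₁ _ (hf₁ hB)]
    exact hκB
  · ext x A hA
    rw [← hcomap₂] at hA
    obtain ⟨B, hB, rfl⟩ := hA
    have hκB := congrArg (fun η => η x (Prod.snd ⁻¹' B)) hκ₂
    simp only [map_apply' _ (hπ₂.comp hjm) _ (measurable_snd hB),
      map_apply' _ hg₂ _ (measurable_snd hB)] at hκB
    rw [map_apply' _ hp₂ _ (hf₂ hB)]
    exact hκB

end ProbabilityTheory.Kernel

instance RadonSubprobKernel.isFiniteKernel_ker {X : Type u} [MeasurableSpace X]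
    (S : RadonSubprobKernel.{u, v} X) : IsFiniteKernel S.ker :=
  ⟨1, ENNReal.one_lt_top, S.ker_univ_le_one⟩

theorem RadonSubprobKernel.map_ker {X : Type u} [MeasurableSpace X]
    {S T : RadonSubprobKernel.{u, v} X} (h : S ⟶ T) : S.ker.map h = T.ker := by
  ext x A hA
  rw [Kernel.map_apply' _ (Hom.measurable_toFun h) _ hA]
  exact Hom.ker_preimage h x A hA

theorem mainTheorem1 {X : Type u} [MeasurableSpace X] {S₁ S₀ S₂ : RadonSubprobKernel.{u, v} X}
    (h₁ : S₁ ⟶ S₀) (h₂ : S₂ ⟶ S₀) :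
    MeasurableSet (RadonSubprobKernel.setPullback h₁ h₂) ∧
    ∃ (μ₃ : Kernel X (RadonSubprobKernel.setPullback h₁ h₂))
      (h_le : ∀ x, μ₃ x Set.univ ≤ 1) (h_radon : ∀ x, (μ₃ x).InnerRegular)
      (k₁ : RadonSubprobKernel.ofSubsetProd
        (RadonSubprobKernel.setPullback h₁ h₂) μ₃ h_le h_radon ⟶ S₁)
      (k₂ : RadonSubprobKernel.ofSubsetProd
        (RadonSubprobKernel.setPullback h₁ h₂) μ₃ h_le h_radon ⟶ S₂),
      (∀ p : RadonSubprobKernel.setPullback h₁ h₂, k₁ p = p.1.1) ∧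
      (∀ p : RadonSubprobKernel.setPullback h₁ h₂, k₂ p = p.1.2) ∧
      RadonSubprobKernel.IsSemipullback h₁ h₂ k₁ k₂ := by
  have hh₁ := RadonSubprobKernel.Hom.measurable_toFun h₁
  have hh₂ := RadonSubprobKernel.Hom.measurable_toFun h₂
  have hT : MeasurableSet (RadonSubprobKernel.setPullback h₁ h₂) :=
    measurableSet_eq_fun (hh₁.comp measurable_fst) (hh₂.comp measurable_snd)
  obtain ⟨μ, hμ₁, hμ₂⟩ : ∃ μ : Kernel X (RadonSubprobKernel.setPullback h₁ h₂),
      μ.map (fun p => p.1.1) = S₁.ker ∧ μ.map (fun p => p.1.2) = S₂.ker :=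
    Kernel.exists_pullback S₁.ker S₂.ker S₁.ker_radon S₂.ker_radon hh₁ hh₂
      ((RadonSubprobKernel.map_ker h₁).trans (RadonSubprobKernel.map_ker h₂).symm)
  have hp₁ : Measurable fun p : RadonSubprobKernel.setPullback h₁ h₂ => p.1.1 :=
    measurable_fst.comp measurable_subtype_coe
  have hp₂ : Measurable fun p : RadonSubprobKernel.setPullback h₁ h₂ => p.1.2 :=
    measurable_snd.comp measurable_subtype_coe
  have hle x : μ x Set.univ ≤ 1 := by
    rw [← Set.preimage_univ (f := fun p : RadonSubprobKernel.setPullback h₁ h₂ => p.1.1),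
      ← Kernel.map_apply' μ hp₁ x .univ]
    exact hμ₁ ▸ S₁.ker_univ_le_one x
  have : IsFiniteKernel μ := ⟨1, ENNReal.one_lt_top, hle⟩
  have hradon x : (μ x).InnerRegular := by
    refine Measure.InnerRegular.of_marginals hT ?_ ?_
    · rw [← Kernel.map_apply μ hp₁]
      exact hμ₁ ▸ S₁.ker_radon x
    · rw [← Kernel.map_apply μ hp₂]
      exact hμ₂ ▸ S₂.ker_radon x
  refine ⟨hT, μ, hle, hradon,
    ⟨fun p => p.1.1, hp₁, fun a => ?_, fun x A hA => ?_⟩,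
    ⟨fun p => p.1.2, hp₂, fun b => ?_, fun x A hA => ?_⟩,
    fun _ => rfl, fun _ => rfl, RadonSubprobKernel.Hom.ext (funext fun p => p.2)⟩
  -- Surjectivity of each projection comes from that of the opposite leg of the cospan.
  · obtain ⟨b, hb⟩ := RadonSubprobKernel.Hom.surjective_toFun h₂ (h₁ a)
    exact ⟨⟨(a, b), hb.symm⟩, rfl⟩
  · rw [← hμ₁, Kernel.map_apply' μ hp₁ x hA]
    rfl
  · obtain ⟨a, ha⟩ := RadonSubprobKernel.Hom.surjective_toFun h₁ (h₂ b)
    exact ⟨⟨(a, b), ha⟩, rfl⟩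
  · rw [← hμ₂, Kernel.map_apply' μ hp₂ x hA]
    rfl
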